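/- Let $n \ge 1$, let $M_n$ be the perfect matching graph with vertex set $V=\{1,\dots,2n\}$ and edges $\{i,n+i\}$ for $1\le i\le n$. For $r\ge 1$ let $\mathscr{P}^r(M_n)$ be the family of all $r$-element subsets of $V$ that are independent in $M_n$ or contain an independent set of maximum size (the independence number of $M_n$), and for $x\in V$ let $\mathscr{P}^r_x(M_n)=\{A\in\mathscr{P}^r(M_n): x\in A\}$. Let $k\ge 2$ and $1\le r\le \frac{(k-1)(2n)}{k}$, and let $\mathcal{F}\subseteq\mathscr{P}^r(M_n)$ be $k$-wise intersecting, i.e. $F_1\cap\dots\cap F_k\ne\emptyset$ for all (not necessarily distinct) $F_1,\dots,F_k\in\mathcal{F}$. Then $$|\mathcal{F}|\le B(n,r):=\begin{cases}2^{r-1}\binom{n-1}{r-1} & \text{if } r\le n,\\[2pt] 2^{2n-r}\binom{n-1}{2n-r}+2^{2n-r-1}\binom{n-1}{2n-r-1} & \text{if } r>n.\end{cases}$$ If $r<\frac{(k-1)(2n)}{k}$, then $|\mathcal{F}|=B(n,r)$ if and only if $\mathcal{F}=\mathscr{P}^r_x(M_n)$ for some $x\in V$. Moreover, if $r>n$,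 then $|\mathscr{P}^r_x(M_n)|=2^{2n-r}\binom{n-1}{2n-r}+2^{2n-r-1}\binom{n-1}{2n-r-1}$ for every $x\in V$. -/

import Mathlib

/-- The perfect matching graph `M_n`: the vertices are `0, 1, …, 2n - 1`, and the edges are the
`n` pairs `{i, i + n}` with `i < n`. -/
def matchingGraph (n : ℕ) : SimpleGraph (Fin (2 * n)) where
  Adj u v := u.val + n = v.val ∨ v.val + n = u.val
  symm := ⟨fun _ _ h => h.symm⟩
  loopless := ⟨fun u h => by have := u.isLt; omega⟩

/-- The sets of vertices that are independent, or contain an independent set of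
size `α(G)` (the independence number of `G`). -/
def InP {V : Type*} (G : SimpleGraph V) (A : Finset V) : Prop :=
  G.IsIndepSet (A : Set V) ∨ ∃ B : Finset V, B ⊆ A ∧ G.IsNIndepSet G.indepNum B

open Classical in
/-- `𝒫^r(G)`: the `r`-subsets of the vertex set that are independent or contain a maximum
independent set. -/
noncomputable def familyP {V : Type*} [Fintype V] (G : SimpleGraph V) (r : ℕ) :
    Finset (Finset V) :=
  Finset.univ.filter fun A => InP G A ∧ A.card = r

open Classical in
/-- `𝒫^r_x(G)`: the star in `𝒫^r(G)` centered at the vertex `x`. -/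
noncomputable def starP {V : Type*} [Fintype V] (G : SimpleGraph V) (r : ℕ) (x : V) :
    Finset (Finset V) :=
  (familyP G r).filter fun A => x ∈ A

/-- A family is `k`-wise intersecting if any `k` of its members, not necessarily distinct, have
a common element. -/
def KWiseIntersecting {V : Type*} (k : ℕ) (F : Finset (Finset V)) : Prop :=
  ∀ A : Fin k → Finset V, (∀ i, A i ∈ F) → ∃ x, ∀ i, x ∈ A i

/-- The bound on the size of the family. It is used for `1 ≤ r < 2n` only, where no
subtraction below truncates. -/
def matchingBound (n r : ℕ) : ℕ :=
  if r ≤ n then 2 ^ (r - 1) * (n - 1).choose (r - 1)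
  else 2 ^ (2 * n - r) * (n - 1).choose (2 * n - r)
    + 2 ^ (2 * n - r - 1) * (n - 1).choose (2 * n - r - 1)

/-!
The proof is Katona's cycle method, applied to the complements. Put `t = 2 * n - r` and replace
every member of the family by its complement: a family is `k`-wise intersecting if and only if no
`k` of these `t`-sets cover the vertices, and the condition on `r` becomes `2 * n ≤ k * t`. Both a
member of `𝒫^r(M_n)` and its complement are *balanced*: independent, or of independent complement.

Place the vertices on a cycle of length `2 * n` with partners opposite to each other. Then every arc
is balanced, and the automorphisms of the matching act transitively on the balanced sets of a
given size. So it suffices to bound, in each of the arrangements that arise from automorphisms, the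
number of arcs in the family, and this bound is attained by stars in every arrangement
(`exists_sum_card_arcStarts`). If no `k` of a set of arcs of length `t` cover a cycle of length
`N ≤ k * t`, then there are at most `N - t` of them: a chain of arcs, each starting where the
previous one ends, covers the cycle, so each of `t` disjoint chains has a missing member
(`card_le_of_no_cover`). If `N < k * t`, then equality holds only for the arcs that avoid a point
(`exists_center_of_card_eq`).

For the uniqueness, an extremal family has a center in every arrangement. The main step is that
exchanging two neighboring positions, with their partners, away from the center does not move it
(`Centered.mul_adjSwap`): otherwise the family contains a set that differs from an arc through
the center by this exchange, and `k - 1` arcs that avoid the center cover the rest. These exchanges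
turn the arcs through the center `p` into all independent sets that contain `p`
(`exists_smul_arc_eq`). This determines which independent `t`-sets through `p` (for `t ≤ n`), or
which complements of independent sets through `p` (for `n ≤ t`), are in the family, and gives one
inclusion between the family and the complements of the star at `p`. They have equal size.

The size of a star follows from the number `2 ^ t * n.choose t` of independent `t`-sets by the same
averaging (`two_mul_card_costar`).
-/

namespace MatchingEKR

open Finset
open scoped Pointwise

/-! ### Independent sets for a fixed-point-free involution -/

section Involution

variable {V : Type*} [DecidableEq V]

/-- `A` meets no pair `{v, ν v}` twice: for a fixed-point-free involution `ν` this says that `A` is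
independent in the perfect matching whose edges are the orbits of `ν`. -/
def Indep (ν : V → V) (A : Finset V) : Prop := ∀ v ∈ A, ν v ∉ A

/-- The symmetry of the matching `ν` that exchanges `a` with `b`, and `ν a` with `ν b`. For
`b = ν a` it is the transposition of `a` and `ν a`. -/
def pairSwap (ν : V → V) (hν : ∀ x, ν (ν x) = x) (hne : ∀ x, ν x ≠ x)
    (a b : V) : Equiv.Perm V :=
  Function.Involutive.toPerm
    (fun x => if x = a then b else if x = b then a else if x = ν a then ν b
      else if x = ν b then ν a else x)
    (by
      intro x
      have := hν a
      have := hν b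
      have := hν x
      have := hne a
      have := hne b
      dsimp only
      grind)

variable {ν : V → V} (hν : ∀ x, ν (ν x) = x) (hne : ∀ x, ν x ≠ x)

theorem pairSwap_apply (a b x : V) : pairSwap ν hν hne a b x =
    if x = a then b else if x = b then a else if x = ν a then ν b
      else if x = ν b then ν a else x := rfl

theorem pairSwap_comm_involution (a b x : V) :
    pairSwap ν hν hne a b (ν x) = ν (pairSwap ν hν hne a b x) := by
  have := hν a
  have := hν b
  have := hν x
  have := hne a
  have := hne b
  have := hne x
  simp only [pairSwap_apply]
  grind

theorem Indep.smul {A : Finset V} (hA : Indep ν A) {g : Equiv.Perm V}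
    (hg : ∀ x, g (ν x) = ν (g x)) : Indep ν (g • A) := by
  intro v hv hv'
  obtain ⟨u, hu, rfl⟩ := mem_smul_finset.1 hv
  rw [Equiv.Perm.smul_def, ← hg, ← Equiv.Perm.smul_def, smul_mem_smul_finset_iff] at hv'
  exact hA u hu hv'

theorem smul_compl [Fintype V] (g : Equiv.Perm V) (A : Finset V) : g • Aᶜ = (g • A)ᶜ := by
  ext x
  simp [← inv_smul_mem_iff]

/-- The exchange step: a pair swap between `A \ B` and `B \ A` brings `A` closer to `B`. -/
theorem card_inter_lt_pairSwap {A B : Finset V} (hA : Indep ν A) (hB : Indep ν B) {a b : V}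
    (haA : a ∈ A) (haB : a ∉ B) (hbB : b ∈ B) (hbA : b ∉ A) :
    #(A ∩ B) < #((pairSwap ν hν hne a b • A) ∩ B) := by
  have h : insert b (A ∩ B) ⊆ (pairSwap ν hν hne a b • A) ∩ B := by
    intro x hx
    rcases mem_insert.1 hx with rfl | hx
    · refine mem_inter.2 ⟨mem_smul_finset.2 ⟨a, haA, ?_⟩, hbB⟩
      simp [pairSwap_apply]
    · obtain ⟨hxA, hxB⟩ := mem_inter.1 hx
      refine mem_inter.2 ⟨mem_smul_finset.2 ⟨x, hxA, ?_⟩, hxB⟩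
      have h1 : x ≠ a := by rintro rfl; exact haB hxB
      have h2 : x ≠ b := by rintro rfl; exact hbA hxA
      have h3 : x ≠ ν a := by rintro rfl; exact hA a haA hxA
      have h4 : x ≠ ν b := by rintro rfl; exact hB b hbB hxB
      simp [pairSwap_apply, h1, h2, h3, h4]
  have h5 := card_le_card h
  rw [card_insert_of_notMem (fun h => hbA (mem_inter.1 h).1)] at h5
  omega

/-- Independent sets with the same number of vertices of each color are related by a product of
pair swaps of equally colored vertices. -/
theorem exists_smul_eq_of_card_color_eq [Fintype V] {ι : Type*} [DecidableEq ι]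
    (χ : V → ι) (hχ : ∀ a b, χ a = χ b → χ (ν a) = χ (ν b)) (H : Submonoid (Equiv.Perm V))
    (hH : ∀ a b, χ a = χ b → pairSwap ν hν hne a b ∈ H) {A B : Finset V} (hA : Indep ν A)
    (hB : Indep ν B) (hAB : ∀ c, #{x ∈ A | χ x = c} = #{x ∈ B | χ x = c}) :
    ∃ h ∈ H, h • A = B := by
  induction hd : #B - #(A ∩ B) using Nat.strong_induction_on generalizing A with
  | _ d ih =>
  by_cases hBA : B ⊆ A
  · refine ⟨1, H.one_mem, ?_⟩
    rw [one_smul]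
    refine (eq_of_subset_of_card_le hBA ?_).symm
    rw [card_eq_sum_card_fiberwise (f := χ) (t := univ.image χ) (by simp [Set.MapsTo]),
      card_eq_sum_card_fiberwise (s := B) (f := χ) (t := univ.image χ) (by simp [Set.MapsTo])]
    exact (sum_congr rfl fun c _ => hAB c).le
  · obtain ⟨b, hbB, hbA⟩ := not_subset.1 hBA
    obtain ⟨a, ha, haB⟩ : ∃ a ∈ {x ∈ A | χ x = χ b}, a ∉ {x ∈ B | χ x = χ b} := by
      by_contra! hcon
      have := eq_of_subset_of_card_le hcon (hAB (χ b)).ge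
      have hb : b ∈ {x ∈ B | χ x = χ b} := by simp [hbB]
      rw [← this] at hb
      exact hbA (mem_filter.1 hb).1
    obtain ⟨haA, hab⟩ := mem_filter.1 ha
    have haB : a ∉ B := fun h => haB (mem_filter.2 ⟨h, hab⟩)
    have hlt := card_inter_lt_pairSwap hν hne hA hB haA haB hbB hbA
    set g := pairSwap ν hν hne a b with hg
    have hχg : ∀ x, χ (g x) = χ x := by
      intro x
      have := hχ a b hab
      rw [hg, pairSwap_apply]
      grind
    have hle : #((g • A) ∩ B) ≤ #B := card_le_card inter_subset_right
    obtain ⟨h, hhH, hh⟩ := ih (#B - #((g • A) ∩ B)) (by omega)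
      (hA.smul (pairSwap_comm_involution hν hne a b))
      (fun c => by
        rw [← hAB c, ← card_smul_finset g {x ∈ A | χ x = c}]
        congr 1
        ext x
        simp only [mem_filter, ← inv_smul_mem_iff]
        rw [← hχg (g⁻¹ • x)]
        simp [Equiv.Perm.smul_def, ← hg]) rfl
    exact ⟨h * g, H.mul_mem hhH (hH a b hab), by rw [mul_smul, hh]⟩

/-- The automorphism group of the matching `ν`. -/
def matchingAut (ν : V → V) : Subgroup (Equiv.Perm V) where
  carrier := {g | ∀ x, g (ν x) = ν (g x)}
  mul_mem' := by
    intro g h hg hh x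
    simp only [Set.mem_ofPred_eq] at hg hh
    rw [Equiv.Perm.mul_apply, hh, hg, Equiv.Perm.mul_apply]
  one_mem' := fun _ => rfl
  inv_mem' := by
    intro g hg x
    simp only [Set.mem_ofPred_eq] at hg
    rw [Equiv.Perm.inv_eq_iff_eq, hg]
    simp

theorem mem_matchingAut {V : Type*} {ν : V → V} {g : Equiv.Perm V} :
    g ∈ matchingAut ν ↔ ∀ x, g (ν x) = ν (g x) :=
  Iff.rfl

variable [Fintype V]

/-- `A` is independent, or contains a vertex of every pair `{v, ν v}`. -/
def IsBalanced (ν : V → V) (A : Finset V) : Prop := Indep ν A ∨ Indep ν Aᶜ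

theorem Indep.two_mul_card_le {A : Finset V} (hν : ∀ x, ν (ν x) = x) (hA : Indep ν A) :
    2 * #A ≤ Fintype.card V := by
  have hinj : Function.Injective ν := Function.Involutive.injective hν
  have hdisj : Disjoint A (A.image ν) := by
    rw [disjoint_left]
    intro x hx hx'
    obtain ⟨y, hy, rfl⟩ := mem_image.1 hx'
    exact hA y hy hx
  have := card_le_univ (A ∪ A.image ν)
  rw [card_union_of_disjoint hdisj, card_image_of_injective _ hinj] at this
  omega

/-- A set of half the vertices is independent as soon as its complement is. -/
theorem Indep.of_compl {A : Finset V} (hν : ∀ x, ν (ν x) = x) (hA : Indep ν Aᶜ)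
    (hcard : 2 * #A ≤ Fintype.card V) : Indep ν A := by
  have hinj : Function.Injective ν := Function.Involutive.injective hν
  have hsub : Aᶜ.image ν ⊆ A := by
    intro x hx
    obtain ⟨y, hy, rfl⟩ := mem_image.1 hx
    simpa using hA y hy
  have h1 : #(Aᶜ.image ν) = Fintype.card V - #A := by
    rw [card_image_of_injective _ hinj, card_compl]
  have h2 := eq_of_subset_of_card_le hsub (by omega)
  intro v hv hv'
  rw [← h2] at hv
  obtain ⟨y, hy, rfl⟩ := mem_image.1 hv
  rw [hν] at hv'
  exact (mem_compl.1 hy) hv'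

theorem IsBalanced.indep {A : Finset V} (hν : ∀ x, ν (ν x) = x) (hA : IsBalanced ν A)
    (hcard : 2 * #A ≤ Fintype.card V) : Indep ν A :=
  hA.elim id fun h => h.of_compl hν hcard

theorem IsBalanced.compl {A : Finset V} (hA : IsBalanced ν A) : IsBalanced ν Aᶜ := by
  unfold IsBalanced
  rw [compl_compl]
  exact hA.symm

theorem IsBalanced.indep_compl {A : Finset V} (hν : ∀ x, ν (ν x) = x) (hA : IsBalanced ν A)
    (hcard : Fintype.card V ≤ 2 * #A) : Indep ν Aᶜ := by
  refine hA.compl.indep hν ?_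
  rw [card_compl]
  omega

theorem IsBalanced.smul {A : Finset V} (hA : IsBalanced ν A) {g : Equiv.Perm V}
    (hg : g ∈ matchingAut ν) : IsBalanced ν (g • A) := by
  unfold IsBalanced
  rw [← smul_compl]
  exact hA.imp (fun h => h.smul hg) (fun h => h.smul hg)

/-- The automorphism group of a matching is transitive on the balanced sets of a given size. -/
theorem IsBalanced.exists_smul_eq (hν : ∀ x, ν (ν x) = x) (hne : ∀ x, ν x ≠ x) {A B : Finset V}
    (hA : IsBalanced ν A) (hB : IsBalanced ν B) (hAB : #A = #B) :
    ∃ g ∈ matchingAut ν, g • A = B := by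
  have key : ∀ {A B : Finset V}, Indep ν A → Indep ν B → #A = #B →
      ∃ g ∈ matchingAut ν, g • A = B := by
    intro A B hA hB hAB
    exact exists_smul_eq_of_card_color_eq hν hne (fun _ => ()) (fun _ _ _ => rfl)
      (matchingAut ν).toSubmonoid (fun a b _ => pairSwap_comm_involution hν hne a b) hA hB
      (fun c => by simpa using hAB)
  rcases le_total (2 * #A) (Fintype.card V) with h | h
  · exact key (hA.indep hν h) (hB.indep hν (hAB ▸ h)) hAB
  · obtain ⟨g, hg, hgA⟩ := key (hA.indep_compl hν h) (hB.indep_compl hν (hAB ▸ h))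
      (by rw [card_compl, card_compl, hAB])
    refine ⟨g, hg, ?_⟩
    rwa [smul_compl, compl_inj_iff] at hgA

end Involution

/-! ### Arcs on a cycle -/

section Arcs

variable {N : ℕ} [NeZero N]

/-- The arc `a, a + 1, …, a + s - 1` on the cycle `ZMod N`. -/
def arc (s : ℕ) (a : ZMod N) : Finset (ZMod N) := {y | (y - a).val < s}

theorem mem_arc {s : ℕ} {a y : ZMod N} : y ∈ arc s a ↔ (y - a).val < s := by
  simp [arc]

theorem mem_arc_iff_exists {s : ℕ} {a y : ZMod N} : y ∈ arc s a ↔ ∃ d < s, y = a + (d : ℕ) := by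
  rw [mem_arc]
  constructor
  · intro h
    exact ⟨_, h, by rw [ZMod.natCast_zmod_val]; ring⟩
  · rintro ⟨d, hd, rfl⟩
    rw [add_sub_cancel_left, ZMod.val_natCast]
    exact (Nat.mod_le _ _).trans_lt hd

theorem card_arc {s : ℕ} (hs : s ≤ N) (a : ZMod N) : #(arc s a) = s := by
  have h : arc s a = (range s).image fun d : ℕ => a + (d : ZMod N) := by
    ext y
    simp only [mem_arc_iff_exists, mem_image, mem_range]
    exact exists_congr fun d => and_congr_right fun _ => eq_comm
  rw [h, card_image_of_injOn, card_range]
  intro d hd e he hde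
  simp only [coe_range, Set.mem_Iio] at hd he
  have := congrArg ZMod.val (add_left_cancel hde)
  rwa [ZMod.val_natCast_of_lt (by omega), ZMod.val_natCast_of_lt (by omega)] at this

/-- The arcs of length `s` containing `y` start in the arc of length `s` that ends in `y`. -/
theorem mem_arc_comm {s : ℕ} {a y : ZMod N} : y ∈ arc s a ↔ a ∈ arc s (y + 1 - (s : ZMod N)) := by
  simp only [mem_arc_iff_exists]
  constructor
  · rintro ⟨d, hd, rfl⟩
    refine ⟨s - 1 - d, by omega, ?_⟩
    rw [Nat.cast_sub (by omega), Nat.cast_sub (by omega)]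
    push_cast
    ring
  · rintro ⟨d, hd, h⟩
    refine ⟨s - 1 - d, by omega, ?_⟩
    rw [Nat.cast_sub (by omega), Nat.cast_sub (by omega), h]
    push_cast
    ring

theorem card_filter_mem_arc {s : ℕ} (hs : s ≤ N) (y : ZMod N) : #{a | y ∈ arc s a} = s := by
  have h : ({a | y ∈ arc s a} : Finset (ZMod N)) = arc s (y + 1 - (s : ZMod N)) := by
    ext a
    simp [← mem_arc_comm]
  rw [h, card_arc hs]

theorem card_filter_notMem_arc {s : ℕ} (hs : s ≤ N) (y : ZMod N) :
    #{a | y ∉ arc s a} = N - s := by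
  have h := card_filter_add_card_filter_not (s := (univ : Finset (ZMod N))) (fun a => y ∈ arc s a)
  rw [card_filter_mem_arc hs, card_univ, ZMod.card] at h
  omega

theorem val_sub_natCast_add {y a : ZMod N} {s : ℕ} (hs : s ≤ (y - a).val) :
    (y - (a + s)).val = (y - a).val - s := by
  have h : y - (a + s) = (((y - a).val - s : ℕ) : ZMod N) := by
    rw [Nat.cast_sub hs, ZMod.natCast_zmod_val]
    ring
  rw [h, ZMod.val_natCast_of_lt]
  have := ZMod.val_lt (y - a)
  omega

theorem compl_arc {s : ℕ} (hs : s ≤ N) (a : ZMod N) :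
    (arc s a)ᶜ = arc (N - s) (a + (s : ZMod N)) := by
  refine eq_of_subset_of_card_le ?_ ?_
  · intro y hy
    rw [mem_compl, mem_arc, not_lt] at hy
    have := ZMod.val_lt (y - a)
    rw [mem_arc, val_sub_natCast_add hy]
    omega
  · rw [card_compl, ZMod.card, card_arc hs, card_arc (by omega)]

end Arcs

/-! ### Arcs of which no `k` cover the cycle -/

theorem exists_step_of_mem_chain {j m z t : ℕ} (h1 : j ≤ z) (h2 : z < j + m * t) :
    ∃ i < m, j + i * t ≤ z ∧ z < j + i * t + t := by
  have ht : 0 < t := by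
    rcases Nat.eq_zero_or_pos t with rfl | h
    · omega
    · exact h
  refine ⟨(z - j) / t, (Nat.div_lt_iff_lt_mul ht).2 (by omega), ?_, ?_⟩
  · have := Nat.div_mul_le_self (z - j) t
    omega
  · have := Nat.lt_div_mul_add ht (a := z - j)
    omega

/-- The length of the chain `j, j + t, j + 2t, …` before it reaches `N`. -/
theorem exists_chain_length {N k t : ℕ} (j : ℕ) (hk : N ≤ j + k * t) :
    ∃ m ≤ k, N ≤ j + m * t ∧ ∀ i < m, j + i * t < N := by
  classical
  have h : ∃ m, N ≤ j + m * t := ⟨k, hk⟩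
  exact ⟨Nat.find h, Nat.find_min' h hk, Nat.find_spec h, fun i hi => not_le.1 (Nat.find_min h hi)⟩

section Cycle

variable {N : ℕ} [NeZero N] {k t : ℕ} {S : Finset (ZMod N)}

/-- The covering condition in terms of offsets from an origin `s`. As arcs may wrap around the
cycle, a point with offset `y` is also the one with offset `y + N`. -/
theorem exists_uncovered_offset
    (hS : ∀ D ⊆ S, #D ≤ k → ∃ y, ∀ a ∈ D, y ∉ arc t a) (s : ZMod N) (D : Finset ℕ)
    (hD : #D ≤ k) (hDS : ∀ d ∈ D, s + (d : ZMod N) ∈ S) :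
    ∃ y < N, ∀ d ∈ D, ∀ z, z = y ∨ z = y + N → d ≤ z → z < d + t → False := by
  obtain ⟨y, hy⟩ := hS (D.image fun d : ℕ => s + (d : ZMod N)) (by
    intro a ha
    obtain ⟨d, hd, rfl⟩ := mem_image.1 ha
    exact hDS d hd) (card_image_le.trans hD)
  refine ⟨(y - s).val, ZMod.val_lt _, fun d hd z hz h1 h2 => ?_⟩
  refine hy _ (mem_image_of_mem _ hd) (mem_arc_iff_exists.2 ⟨z - d, by omega, ?_⟩)
  have hz' : (z : ZMod N) = y - s := by
    rcases hz with rfl | rfl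
    · exact ZMod.natCast_zmod_val _
    · rw [Nat.cast_add, ZMod.natCast_zmod_val, ZMod.natCast_self, add_zero]
  rw [Nat.cast_sub h1, hz']
  ring

theorem exists_offset_notMem (hk : N ≤ k * t)
    (hS : ∀ D ⊆ S, #D ≤ k → ∃ y, ∀ a ∈ D, y ∉ arc t a) {s : ZMod N} (hs : s ∈ S) {j : ℕ}
    (hj1 : 1 ≤ j) (hjt : j ≤ t) : ∃ i, j + i * t < N ∧ s + ((j + i * t : ℕ) : ZMod N) ∉ S := by
  by_contra! hcon
  obtain ⟨m, hmk, hm, hlt⟩ := exists_chain_length (k := k) j (by omega : N ≤ j + k * t)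
  have hcard : #((range m).image fun i => j + i * t) ≤ m := card_image_le.trans_eq (card_range m)
  have hmem : ∀ d ∈ (range m).image fun i => j + i * t, s + (d : ZMod N) ∈ S := by
    intro d hd
    obtain ⟨i, hi, rfl⟩ := mem_image.1 hd
    exact hcon i (hlt i (mem_range.1 hi))
  rcases hmk.eq_or_lt with rfl | hmk
  · -- A chain of `k` arcs covers everything by itself.
    have hjN : j + 0 * t < N := hlt 0 (by
      rcases m.eq_zero_or_pos with rfl | h
      · have := NeZero.pos N
        omega
      · exact h)
    obtain ⟨y, hy, h⟩ := exists_uncovered_offset hS s _ hcard hmem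
    obtain ⟨z, hz, h1, h2⟩ : ∃ z, (z = y ∨ z = y + N) ∧ j ≤ z ∧ z < j + m * t := by
      by_cases hyj : j ≤ y
      · exact ⟨y, Or.inl rfl, hyj, by omega⟩
      · exact ⟨y + N, Or.inr rfl, by omega, by omega⟩
    obtain ⟨i, hi, h3, h4⟩ := exists_step_of_mem_chain h1 h2
    exact h _ (mem_image_of_mem _ (mem_range.2 hi)) z hz h3 h4
  · -- A shorter chain covers everything together with the arc at `s`.
    obtain ⟨y, hy, h⟩ := exists_uncovered_offset hS s
      (insert 0 ((range m).image fun i => j + i * t))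
      ((card_insert_le _ _).trans (by omega)) (by
        intro d hd
        rcases mem_insert.1 hd with rfl | hd
        · simpa using hs
        · exact hmem d hd)
    by_cases hyj : j ≤ y
    · obtain ⟨i, hi, h3, h4⟩ := exists_step_of_mem_chain hyj (by omega : y < j + m * t)
      exact h _ (mem_insert_of_mem (mem_image_of_mem _ (mem_range.2 hi))) y (Or.inl rfl) h3 h4
    · exact h 0 (mem_insert_self _ _) y (Or.inl rfl) (by omega) (by omega)

theorem card_offset_notMem (s : ZMod N) :
    #{d ∈ range N | s + ((d : ℕ) : ZMod N) ∉ S} = N - #S := by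
  have h : #Sᶜ = N - #S := by rw [card_compl, ZMod.card]
  rw [← h]
  refine card_nbij' (fun d => s + ((d : ℕ) : ZMod N)) (fun a => (a - s).val) ?_ ?_ ?_ ?_
  · intro d hd
    simpa using (mem_filter.1 hd).2
  · intro a ha
    simp only [coe_filter, Set.mem_ofPred_eq, mem_range, ZMod.natCast_zmod_val]
    exact ⟨ZMod.val_lt _, by simpa using ha⟩
  · intro d hd
    have := mem_range.1 (mem_filter.1 hd).1
    simp only [add_sub_cancel_left]
    exact ZMod.val_natCast_of_lt this
  · intro a _
    simp

theorem image_offset_notMem (hk : N ≤ k * t)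
    (hS : ∀ D ⊆ S, #D ≤ k → ∃ y, ∀ a ∈ D, y ∉ arc t a) {s : ZMod N} (hs : s ∈ S) :
    range t ⊆ {d ∈ range N | s + ((d : ℕ) : ZMod N) ∉ S}.image fun d => (d - 1) % t := by
  intro j hj
  obtain ⟨i, hi, hiS⟩ := exists_offset_notMem hk hS hs (j := j + 1) (by omega)
    (by have := mem_range.1 hj; omega)
  refine mem_image.2 ⟨j + 1 + i * t, mem_filter.2 ⟨mem_range.2 hi, hiS⟩, ?_⟩
  rw [show j + 1 + i * t - 1 = j + i * t by omega, Nat.add_mul_mod_self_right,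
    Nat.mod_eq_of_lt (mem_range.1 hj)]

/-- If no `k` of the arcs of length `t` that start in `S` cover the cycle of length `N ≤ k * t`,
then there are at most `N - t` of them: seen from a point of `S`, each residue class modulo `t`
has an offset missing from `S`. -/
theorem card_le_of_no_cover (hk : N ≤ k * t)
    (hS : ∀ D ⊆ S, #D ≤ k → ∃ y, ∀ a ∈ D, y ∉ arc t a) : #S ≤ N - t := by
  rcases S.eq_empty_or_nonempty with rfl | ⟨s, hs⟩
  · simp
  · have h1 := (card_le_card (image_offset_notMem hk hS hs)).trans card_image_le
    rw [card_range, card_offset_notMem] at h1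
    have : #S ≤ N := (card_le_univ S).trans_eq (ZMod.card N)
    omega

/-- In the extremal case, the run of missing starts that follows a point of `S` has length at least
`t`. -/
theorem succ_notMem_of_card_eq (htN : t < N) (hk : N < k * t)
    (hS : ∀ D ⊆ S, #D ≤ k → ∃ y, ∀ a ∈ D, y ∉ arc t a) (hcard : #S = N - t) {s : ZMod N}
    (hs : s ∈ S) {c : ℕ} (hc1 : 1 ≤ c) (hct : c < t) (hcS : s + (c : ZMod N) ∉ S) :
    s + ((c + 1 : ℕ) : ZMod N) ∉ S := by
  intro hcS'
  have ht : 0 < t := by omega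
  -- By counting, the missing offsets have distinct residues modulo `t`.
  have hinj : Set.InjOn (fun d => (d - 1) % t)
      ({d ∈ range N | s + ((d : ℕ) : ZMod N) ∉ S} : Finset ℕ) := by
    rw [← card_image_iff]
    refine le_antisymm card_image_le ?_
    have h1 := card_le_card (image_offset_notMem hk.le hS hs)
    rw [card_range] at h1
    rw [card_offset_notMem, hcard]
    omega
  have hchain : ∀ i, c + t + i * t < N → s + ((c + t + i * t : ℕ) : ZMod N) ∈ S := by
    intro i hi
    by_contra hcon
    have := @hinj (c + t + i * t) (by simpa using ⟨hi, by simpa using hcon⟩) c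
      (by simpa using ⟨by omega, hcS⟩) (by
        change (c + t + i * t - 1) % t = (c - 1) % t
        rw [show c + t + i * t - 1 = c - 1 + (i + 1) * t by rw [add_mul]; omega,
          Nat.add_mul_mod_self_right])
    omega
  obtain ⟨K, rfl⟩ : ∃ K, k = K + 1 := ⟨k - 1, by
    rcases k with _ | k
    · omega
    · rfl⟩
  rw [add_mul, one_mul] at hk
  obtain ⟨m, hmk, hm, hlt⟩ := exists_chain_length (k := K) (c + t)
    (by omega : N ≤ c + t + K * t)
  have hcard : #((range m).image fun i => c + t + i * t) ≤ m :=
    card_image_le.trans_eq (card_range m)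
  have hmem : ∀ d ∈ insert (c + 1) ((range m).image fun i => c + t + i * t),
      s + (d : ZMod N) ∈ S := by
    intro d hd
    rcases mem_insert.1 hd with rfl | hd
    · exact hcS'
    · obtain ⟨i, hi, rfl⟩ := mem_image.1 hd
      exact hchain i (hlt i (mem_range.1 hi))
  have hcard' := (card_insert_le (c + 1) ((range m).image fun i => c + t + i * t))
  rcases hmk.eq_or_lt with rfl | hmk
  · -- The arc at `c + 1` and a chain of `k - 1` arcs cover the cycle.
    obtain ⟨y, hy, h⟩ := exists_uncovered_offset hS s _ (hcard'.trans (by omega)) hmem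
    obtain ⟨z, hz, h1, h2⟩ : ∃ z, (z = y ∨ z = y + N) ∧ c + 1 ≤ z ∧ z < c + t + m * t := by
      by_cases hyj : c + 1 ≤ y
      · exact ⟨y, Or.inl rfl, hyj, by omega⟩
      · exact ⟨y + N, Or.inr rfl, by omega, by omega⟩
    by_cases hz' : z < c + 1 + t
    · exact h _ (mem_insert_self _ _) z hz h1 hz'
    · obtain ⟨i, hi, h3, h4⟩ := exists_step_of_mem_chain (by omega : c + t ≤ z) h2
      exact h _ (mem_insert_of_mem (mem_image_of_mem _ (mem_range.2 hi))) z hz h3 h4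
  · -- The arcs at `0` and at `c + 1` and a shorter chain cover the cycle.
    obtain ⟨y, hy, h⟩ := exists_uncovered_offset hS s
      (insert 0 (insert (c + 1) ((range m).image fun i => c + t + i * t)))
      ((card_insert_le _ _).trans (by omega)) (by
        intro d hd
        rcases mem_insert.1 hd with rfl | hd
        · simpa using hs
        · exact hmem d hd)
    by_cases hy1 : y < t
    · exact h 0 (mem_insert_self _ _) y (Or.inl rfl) (by omega) (by omega)
    by_cases hy2 : y < c + 1 + t
    · exact h _ (mem_insert_of_mem (mem_insert_self _ _)) y (Or.inl rfl) (by omega) hy2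
    · obtain ⟨i, hi, h3, h4⟩ := exists_step_of_mem_chain (by omega : c + t ≤ y)
        (by omega : y < c + t + m * t)
      exact h _ (mem_insert_of_mem (mem_insert_of_mem (mem_image_of_mem _ (mem_range.2 hi)))) y
        (Or.inl rfl) h3 h4

/-- If `N < k * t`, then the extremal systems of arcs of length `t`, no `k` of which cover the
cycle, consist of the arcs that avoid a fixed point. -/
theorem exists_center_of_card_eq (ht : 0 < t) (htN : t < N) (hk : N < k * t)
    (hS : ∀ D ⊆ S, #D ≤ k → ∃ y, ∀ a ∈ D, y ∉ arc t a) (hcard : #S = N - t) :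
    ∃ p, ∀ a, a ∈ S ↔ p ∉ arc t a := by
  obtain ⟨s, hs, hs1⟩ : ∃ s ∈ S, s + 1 ∉ S := by
    by_contra! hcon
    obtain ⟨s, hs⟩ : S.Nonempty := card_pos.1 (by omega)
    have hall : ∀ d : ℕ, s + (d : ZMod N) ∈ S := by
      intro d
      induction d with
      | zero => simpa using hs
      | succ d ih => simpa [add_assoc] using hcon _ ih
    have huniv : S = univ := by
      ext a
      simpa using hall (a - s).val
    rw [huniv, card_univ, ZMod.card] at hcard
    omega
  have hrun : ∀ d < t, s + 1 + ((d : ℕ) : ZMod N) ∉ S := by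
    intro d hd
    induction d with
    | zero => simpa using hs1
    | succ d ih =>
      have h := succ_notMem_of_card_eq htN hk hS hcard hs (c := d + 1) (by omega) hd (by
        have := ih (by omega)
        rwa [Nat.cast_add, Nat.cast_one, add_comm (d : ZMod N), ← add_assoc])
      rwa [Nat.cast_add, Nat.cast_one, add_comm (_ : ZMod N) 1, ← add_assoc] at h
  have harc : arc t (s + 1) = Sᶜ := by
    refine eq_of_subset_of_card_le ?_ ?_
    · intro a ha
      obtain ⟨d, hd, rfl⟩ := mem_arc_iff_exists.1 ha
      exact mem_compl.2 (hrun d hd)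
    · rw [card_compl, ZMod.card, card_arc htN.le]
      omega
  refine ⟨s + t, fun a => ?_⟩
  rw [mem_arc_comm, show s + t + 1 - (t : ZMod N) = s + 1 by ring, harc, mem_compl, not_not]

end Cycle

/-! ### Averaging over the symmetries of the matching -/

section Averaging

instance {V : Type*} [Fintype V] [DecidableEq V] (ν : V → V) :
    DecidablePred (· ∈ matchingAut ν) :=
  fun g => inferInstanceAs (Decidable (∀ x, g (ν x) = ν (g x)))

instance {V : Type*} [DecidableEq V] (ν : V → V) : DecidablePred (Indep ν) :=
  fun A => inferInstanceAs (Decidable (∀ v ∈ A, ν v ∉ A))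

instance {V : Type*} [Fintype V] [DecidableEq V] (ν : V → V) : DecidablePred (IsBalanced ν) :=
  fun A => inferInstanceAs (Decidable (Indep ν A ∨ Indep ν Aᶜ))

variable {n : ℕ}

/-- The partner of a vertex. The vertices are placed on a cycle of length `2 * n` with partners
opposite to each other, so that every arc is a balanced set. -/
def opp (x : ZMod (2 * n)) : ZMod (2 * n) := x + n

theorem opp_opp (x : ZMod (2 * n)) : opp (opp x) = x := by
  have h : ((2 * n : ℕ) : ZMod (2 * n)) = 0 := ZMod.natCast_self _
  push_cast at h
  rw [opp, opp, add_assoc, ← two_mul, h, add_zero]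

theorem opp_natCast (i : ℕ) : opp (i : ZMod (2 * n)) = ((i + n : ℕ) : ZMod (2 * n)) := by
  rw [opp, Nat.cast_add]

/-- The rotation of the cycle that moves `0` to `p`. -/
theorem addRight_mem_matchingAut (p : ZMod (2 * n)) :
    Equiv.addRight p ∈ matchingAut (opp (n := n)) := by
  intro x
  simp only [opp, Equiv.coe_addRight]
  ring

variable [NeZero n]

theorem val_opp (x : ZMod (2 * n)) :
    (opp x).val = if x.val < n then x.val + n else x.val - n := by
  have hn := NeZero.pos n
  have hx := ZMod.val_lt x
  rw [opp, ZMod.val_add, ZMod.val_natCast_of_lt (by omega)]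
  split_ifs with h
  · exact Nat.mod_eq_of_lt (by omega)
  · rw [Nat.mod_eq_sub_mod (by omega), Nat.mod_eq_of_lt (by omega)]
    omega

theorem opp_ne (x : ZMod (2 * n)) : opp x ≠ x := by
  intro h
  have hn := NeZero.pos n
  have := congrArg ZMod.val h
  rw [val_opp] at this
  split_ifs at this <;> omega

theorem indep_arc {s : ℕ} (hs : s ≤ n) (a : ZMod (2 * n)) : Indep opp (arc s a) := by
  intro v hv hv'
  have h : opp v - a = opp (v - a) := by
    simp only [opp]
    ring
  rw [mem_arc] at hv hv'
  rw [h, val_opp] at hv'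
  split_ifs at hv' <;> omega

theorem isBalanced_arc {s : ℕ} (hs : s ≤ 2 * n) (a : ZMod (2 * n)) :
    IsBalanced opp (arc s a) := by
  rcases le_total s n with h | h
  · exact Or.inl (indep_arc h a)
  · refine Or.inr ?_
    rw [compl_arc hs]
    exact indep_arc (by omega) _

/-- The balanced sets of size `t`. -/
def balancedSets (n t : ℕ) [NeZero n] : Finset (Finset (ZMod (2 * n))) :=
  {U | IsBalanced opp U ∧ #U = t}

theorem mem_balancedSets {t : ℕ} {U : Finset (ZMod (2 * n))} :
    U ∈ balancedSets n t ↔ IsBalanced opp U ∧ #U = t := by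
  simp [balancedSets]

/-- The starts of the arcs of length `t` that `σ` maps into the family `𝒰`. -/
def arcStarts (t : ℕ) (𝒰 : Finset (Finset (ZMod (2 * n)))) (σ : Equiv.Perm (ZMod (2 * n))) :
    Finset (ZMod (2 * n)) := {a | σ • arc t a ∈ 𝒰}

theorem mem_arcStarts {t : ℕ} {𝒰 : Finset (Finset (ZMod (2 * n)))}
    {σ : Equiv.Perm (ZMod (2 * n))} {a : ZMod (2 * n)} :
    a ∈ arcStarts t 𝒰 σ ↔ σ • arc t a ∈ 𝒰 := by
  simp [arcStarts]

/-- Every balanced set is the image of an arc under the same number of symmetries, by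
transitivity. -/
theorem exists_sum_card_arcStarts {t : ℕ} (ht : t ≤ 2 * n) :
    ∃ c, 0 < c ∧ ∀ 𝒰 ⊆ balancedSets n t,
      ∑ σ : matchingAut (opp (n := n)), #(arcStarts t 𝒰 σ.1) = c * #𝒰 := by
  refine ⟨#{p : matchingAut (opp (n := n)) × ZMod (2 * n) | p.1.1 • arc t p.2 = arc t 0},
    card_pos.2 ⟨(1, 0), by simp⟩, fun 𝒰 h𝒰 => ?_⟩
  have hfib : ∀ U ∈ 𝒰,
      #{p ∈ ({p | p.1.1 • arc t p.2 ∈ 𝒰} :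
        Finset (matchingAut (opp (n := n)) × ZMod (2 * n))) | p.1.1 • arc t p.2 = U} =
      #{p : matchingAut (opp (n := n)) × ZMod (2 * n) | p.1.1 • arc t p.2 = arc t 0} := by
    intro U hU
    obtain ⟨hUb, hUt⟩ := mem_balancedSets.1 (h𝒰 hU)
    obtain ⟨g, hg, hgU⟩ := IsBalanced.exists_smul_eq opp_opp opp_ne hUb (isBalanced_arc ht 0)
      (hUt.trans (card_arc ht 0).symm)
    refine card_nbij' (fun p => (⟨g, hg⟩ * p.1, p.2)) (fun p => (⟨g, hg⟩⁻¹ * p.1, p.2)) ?_ ?_ ?_ ?_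
    · intro p hp
      have hp := (mem_filter.1 hp).2
      simp only [coe_filter, mem_univ, true_and, Set.mem_ofPred_eq, Subgroup.coe_mul, mul_smul, hp,
        hgU]
    · intro p hp
      have hp := (mem_filter.1 hp).2
      have hp' : g⁻¹ • p.1.1 • arc t p.2 = U := by rw [hp, ← hgU, inv_smul_smul]
      simp only [coe_filter, mem_filter, mem_univ, true_and, Set.mem_ofPred_eq, Subgroup.coe_mul,
        mul_smul, Subgroup.coe_inv, hp']
      exact ⟨hU, trivial⟩
    · intro p _
      simp
    · intro p _
      simp
  have hsum := card_eq_sum_card_fiberwise (s := ({p | p.1.1 • arc t p.2 ∈ 𝒰} :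
    Finset (matchingAut (opp (n := n)) × ZMod (2 * n)))) (f := fun p => p.1.1 • arc t p.2)
    (t := 𝒰) (by
      intro p hp
      simpa using hp)
  rw [sum_congr rfl hfib, sum_const, smul_eq_mul, mul_comm #𝒰] at hsum
  rw [← hsum]
  simp only [card_filter, arcStarts, ← univ_product_univ, sum_product]

/-- No `k` members of the family cover the ground set. -/
def NoCover {V : Type*} (k : ℕ) (𝒰 : Finset (Finset V)) : Prop :=
  ∀ D ⊆ 𝒰, #D ≤ k → ∃ y, ∀ U ∈ D, y ∉ U

variable {k t : ℕ} {𝒰 : Finset (Finset (ZMod (2 * n)))}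

theorem NoCover.arcStarts (h : NoCover k 𝒰) (σ : Equiv.Perm (ZMod (2 * n))) :
    ∀ D ⊆ arcStarts t 𝒰 σ, #D ≤ k → ∃ y, ∀ a ∈ D, y ∉ arc t a := by
  intro D hD hDk
  obtain ⟨y, hy⟩ := h (D.image fun a => σ • arc t a) (by
    intro U hU
    obtain ⟨a, ha, rfl⟩ := mem_image.1 hU
    exact mem_arcStarts.1 (hD ha)) (card_image_le.trans hDk)
  refine ⟨σ⁻¹ • y, fun a ha hya => hy _ (mem_image_of_mem _ ha) ?_⟩
  rwa [← inv_smul_mem_iff]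

/-- The balanced sets of size `t` that avoid `x`: the complements of a star. -/
def costar (n t : ℕ) [NeZero n] (x : ZMod (2 * n)) : Finset (Finset (ZMod (2 * n))) :=
  {U ∈ balancedSets n t | x ∉ U}

theorem card_arcStarts_costar (ht : t ≤ 2 * n) (x : ZMod (2 * n))
    (σ : matchingAut (opp (n := n))) : #(arcStarts t (costar n t x) σ.1) = 2 * n - t := by
  rw [← card_filter_notMem_arc ht (σ.1⁻¹ • x)]
  congr 1
  ext a
  simp only [mem_arcStarts, costar, mem_filter, mem_univ, true_and, inv_smul_mem_iff]
  refine and_iff_right (mem_balancedSets.2 ⟨(isBalanced_arc ht a).smul σ.2, ?_⟩)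
  rw [card_smul_finset, card_arc ht]

theorem card_arcStarts_balancedSets (ht : t ≤ 2 * n)
    (σ : matchingAut (opp (n := n))) : #(arcStarts t (balancedSets n t) σ.1) = 2 * n := by
  have h : arcStarts t (balancedSets n t) σ.1 = univ := by
    ext a
    simp only [mem_arcStarts, mem_univ, iff_true]
    exact mem_balancedSets.2 ⟨(isBalanced_arc ht a).smul σ.2, by rw [card_smul_finset, card_arc ht]⟩
  rw [h, card_univ, ZMod.card]

theorem two_mul_card_costar (ht : t ≤ 2 * n) (x : ZMod (2 * n)) :
    2 * n * #(costar n t x) = (2 * n - t) * #(balancedSets n t) := by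
  obtain ⟨c, hc, h⟩ := exists_sum_card_arcStarts (n := n) ht
  have h1 := h (costar n t x) (filter_subset _ _)
  have h2 := h (balancedSets n t) subset_rfl
  simp only [card_arcStarts_costar ht, card_arcStarts_balancedSets ht, sum_const,
    smul_eq_mul] at h1 h2
  refine Nat.eq_of_mul_eq_mul_left hc ?_
  calc c * (2 * n * #(costar n t x)) = 2 * n * (c * #(costar n t x)) := by ring
    _ = (2 * n - t) * (c * #(balancedSets n t)) := by rw [← h1, ← h2]; ring
    _ = _ := by ring

theorem card_le_card_costar (htn : t ≤ 2 * n) (hk : 2 * n ≤ k * t)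
    (h𝒰 : 𝒰 ⊆ balancedSets n t) (hcov : NoCover k 𝒰) (x : ZMod (2 * n)) :
    #𝒰 ≤ #(costar n t x) := by
  obtain ⟨c, hc, h⟩ := exists_sum_card_arcStarts (n := n) htn
  refine Nat.le_of_mul_le_mul_left ?_ hc
  rw [← h _ h𝒰, ← h (costar n t x) (filter_subset _ _)]
  refine sum_le_sum fun σ _ => ?_
  rw [card_arcStarts_costar htn]
  exact card_le_of_no_cover hk (hcov.arcStarts σ.1)

theorem card_arcStarts_of_card_eq (htn : t ≤ 2 * n) (hk : 2 * n ≤ k * t)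
    (h𝒰 : 𝒰 ⊆ balancedSets n t) (hcov : NoCover k 𝒰) {x : ZMod (2 * n)}
    (hcard : #𝒰 = #(costar n t x)) {σ : Equiv.Perm (ZMod (2 * n))}
    (hσ : σ ∈ matchingAut (opp (n := n))) : #(arcStarts t 𝒰 σ) = 2 * n - t := by
  obtain ⟨c, hc, h⟩ := exists_sum_card_arcStarts (n := n) htn
  have h1 := h _ h𝒰
  rw [hcard, ← h (costar n t x) (filter_subset _ _)] at h1
  have h2 := (sum_eq_sum_iff_of_le fun σ _ => by
    rw [card_arcStarts_costar htn]
    exact card_le_of_no_cover hk (hcov.arcStarts σ.1)).1 h1 ⟨σ, hσ⟩ (mem_univ _)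
  rwa [card_arcStarts_costar htn] at h2

end Averaging

/-! ### Extremal families -/

section Extremal

variable {n k t : ℕ} [NeZero n] {𝒰 : Finset (Finset (ZMod (2 * n)))}

/-- An arrangement `σ` of the vertices on the cycle is centered for `𝒰` if the arcs of length `t`
that belong to `𝒰` are those that avoid the position `0`. -/
def Centered (t : ℕ) (𝒰 : Finset (Finset (ZMod (2 * n)))) (σ : Equiv.Perm (ZMod (2 * n))) : Prop :=
  ∀ a, σ • arc t a ∈ 𝒰 ↔ 0 ∉ arc t a

theorem eq_natCast_iff {N m : ℕ} [NeZero N] (hm : m < N) {x : ZMod N} :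
    x = (m : ZMod N) ↔ x.val = m := by
  rw [← ZMod.val_natCast_of_lt hm, (ZMod.val_injective N).eq_iff, ZMod.val_natCast_of_lt hm]

/-- The arcs that avoid the center, together with a member of `𝒰` that covers all but a short
arc avoiding the center, would cover everything. -/
theorem Centered.false_of_compl_subset {K : ℕ} (htn : t < 2 * n) (hcov : NoCover (K + 1) 𝒰)
    {σ : Equiv.Perm (ZMod (2 * n))} (hσ : Centered t 𝒰 σ) {W : Finset (ZMod (2 * n))}
    (hW : σ • W ∈ 𝒰) {u L : ℕ} (hu : 1 ≤ u) (hL : L ≤ K * t)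
    (hWc : ∀ y ∉ W, u ≤ y.val ∧ y.val < u + L) : False := by
  -- The last arcs are moved back so as not to run over the center.
  let b : ℕ → ZMod (2 * n) := fun i => ((min (u + i * t) (2 * n - t) : ℕ) : ZMod (2 * n))
  have hb : ∀ i, σ • arc t (b i) ∈ 𝒰 := by
    intro i
    rw [hσ, mem_arc_iff_exists]
    rintro ⟨d, hd, h⟩
    have h1 : (((min (u + i * t) (2 * n - t) + d : ℕ) : ZMod (2 * n))).val = 0 := by
      rw [Nat.cast_add, ← h, ZMod.val_zero]
    rw [ZMod.val_natCast_of_lt (by omega)] at h1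
    omega
  obtain ⟨z, hz⟩ := hcov (insert (σ • W) ((range K).image fun i => σ • arc t (b i))) (by
    intro U hU
    rcases mem_insert.1 hU with rfl | hU
    · exact hW
    · obtain ⟨i, _, rfl⟩ := mem_image.1 hU
      exact hb i) ((card_insert_le _ _).trans
        (Nat.add_le_add_right (card_image_le.trans_eq (card_range K)) 1))
  have hzW := hz _ (mem_insert_self _ _)
  rw [← inv_smul_mem_iff] at hzW
  obtain ⟨h1, h2⟩ := hWc _ hzW
  have hlt := ZMod.val_lt (σ⁻¹ • z)
  obtain ⟨i, hi, h3, h4⟩ := exists_step_of_mem_chain h1 (by omega : _ < u + K * t)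
  refine hz _ (mem_insert_of_mem (mem_image_of_mem _ (mem_range.2 hi))) ?_
  rw [← inv_smul_mem_iff, mem_arc_iff_exists]
  refine ⟨(σ⁻¹ • z).val - min (u + i * t) (2 * n - t), by omega, ?_⟩
  rw [← Nat.cast_add, Nat.add_sub_cancel' (by omega), ZMod.natCast_zmod_val]

/-- The symmetry that exchanges the neighboring positions `i` and `i + 1`, and their partners. -/
def adjSwap (n i : ℕ) [NeZero n] : Equiv.Perm (ZMod (2 * n)) :=
  pairSwap opp opp_opp opp_ne (i : ZMod (2 * n)) ((i + 1 : ℕ) : ZMod (2 * n))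

theorem val_adjSwap {i : ℕ} (hi : i + 1 < n) (w : ZMod (2 * n)) :
    (adjSwap n i w).val = if w.val = i then i + 1 else if w.val = i + 1 then i
      else if w.val = i + n then i + 1 + n else if w.val = i + 1 + n then i + n else w.val := by
  rw [adjSwap, pairSwap_apply, opp_natCast, opp_natCast]
  simp only [eq_natCast_iff (by omega : i < 2 * n), eq_natCast_iff (by omega : i + 1 < 2 * n),
    eq_natCast_iff (by omega : i + n < 2 * n), eq_natCast_iff (by omega : i + 1 + n < 2 * n)]
  split_ifs
  · exact ZMod.val_natCast_of_lt (by omega)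
  · exact ZMod.val_natCast_of_lt (by omega)
  · exact ZMod.val_natCast_of_lt (by omega)
  · exact ZMod.val_natCast_of_lt (by omega)
  · rfl

theorem adjSwap_mem_matchingAut (i : ℕ) : adjSwap n i ∈ matchingAut (opp (n := n)) :=
  pairSwap_comm_involution opp_opp opp_ne _ _

/-- In an extremal family, exchanging two neighboring positions away from the center does not move
the center. -/
theorem Centered.mul_adjSwap (htn : t < 2 * n) (hk : 2 * n < k * t)
    (hcov : NoCover k 𝒰)
    (hfull : ∀ σ ∈ matchingAut (opp (n := n)), #(arcStarts t 𝒰 σ) = 2 * n - t)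
    {σ : Equiv.Perm (ZMod (2 * n))} (hσG : σ ∈ matchingAut (opp (n := n)))
    (hσ : Centered t 𝒰 σ) {i : ℕ} (hi1 : 1 ≤ i) (hi : i + 1 < n) :
    Centered t 𝒰 (σ * adjSwap n i) := by
  -- As the number of arcs in `𝒰` is known, it is enough that those through `0` do not belong to it.
  suffices h : arcStarts t 𝒰 (σ * adjSwap n i) ⊆ ({a | 0 ∉ arc t a} : Finset (ZMod (2 * n))) by
    have h' := eq_of_subset_of_card_le h (by
      rw [card_filter_notMem_arc htn.le, hfull _ (mul_mem hσG (adjSwap_mem_matchingAut i))])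
    intro a
    rw [← mem_arcStarts, h']
    simp
  intro a ha
  rw [mem_filter]
  refine ⟨mem_univ _, fun h0 => ?_⟩
  rw [mem_arcStarts, mul_smul] at ha
  obtain ⟨j, hj, hja⟩ := mem_arc_iff_exists.1 h0
  have hout : ∀ w, w ∉ arc t a → t ≤ w.val + j ∧ w.val + j < 2 * n := by
    intro w hw
    have hwa : w - a = w + j := by
      rw [eq_comm, ← sub_eq_zero, show w + j - (w - a) = a + j by ring, ← hja]
    have hwl := ZMod.val_lt w
    rw [mem_arc, hwa, ZMod.val_add, ZMod.val_natCast_of_lt (by omega)] at hw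
    rcases lt_or_ge (w.val + j) (2 * n) with h | h
    · rw [Nat.mod_eq_of_lt h] at hw
      omega
    · rw [Nat.mod_eq_sub_mod h, Nat.mod_eq_of_lt (by omega)] at hw
      omega
  have hWc : ∀ y ∉ adjSwap n i • arc t a, ∃ v, t ≤ v + j ∧ v + j < 2 * n ∧
      y.val = if v = i then i + 1 else if v = i + 1 then i
      else if v = i + n then i + 1 + n else if v = i + 1 + n then i + n else v := by
    intro y hy
    rw [← inv_smul_mem_iff] at hy
    obtain ⟨h1, h2⟩ := hout _ hy
    refine ⟨_, h1, h2, ?_⟩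
    rw [← val_adjSwap hi, ← Equiv.Perm.smul_def, smul_inv_smul]
  obtain ⟨K, rfl⟩ : ∃ K, k = K + 1 := ⟨k - 1, by
    rcases k with _ | k
    · omega
    · rfl⟩
  rw [add_mul, one_mul] at hk
  -- The exchange changes an arc at its ends only, so the complement of the changed arc lies in an
  -- arc of length `2 * n - t + 1` if one end changes, and `2 * n - t + 2` if both do. The
  -- remaining `k - 1` arcs can cover length `k * t - t`, which is enough unless both ends change
  -- and `k * t = 2 * n + 1`. But if both ends change, then `t = n`, which excludes this.
  by_cases h2 : 2 * n + 2 ≤ K * t + t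
  · refine hσ.false_of_compl_subset htn hcov ha (u := max 1 (t - j - 1))
      (L := min (2 * n) (2 * n - j + 1) - max 1 (t - j - 1)) (by omega) (by omega) ?_
    intro y hy
    obtain ⟨v, hv1, hv2, hv⟩ := hWc y hy
    split_ifs at hv <;> omega
  have hK : K * t + t = 2 * n + 1 := by omega
  by_cases hl : t - j - 1 = i ∨ t - j - 1 = i + n
  · have hr : ¬ (2 * n - j - 1 = i ∨ 2 * n - j - 1 = i + n) := by
      intro hr
      obtain rfl : t = n := by omega
      have h3 : (K - 1) * t = 1 := by
        rw [Nat.sub_mul]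
        omega
      have := Nat.eq_one_of_mul_eq_one_left h3
      omega
    refine hσ.false_of_compl_subset htn hcov ha (u := t - j - 1)
      (L := 2 * n - t + 1) (by omega) (by omega) ?_
    intro y hy
    obtain ⟨v, hv1, hv2, hv⟩ := hWc y hy
    split_ifs at hv <;> omega
  · refine hσ.false_of_compl_subset htn hcov ha (u := t - j)
      (L := min (2 * n) (2 * n - j + 1) - (t - j)) (by omega) (by omega) ?_
    intro y hy
    obtain ⟨v, hv1, hv2, hv⟩ := hWc y hy
    split_ifs at hv <;> omega

/-- The symmetries generated by the exchanges of neighboring positions strictly between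
`0` and `n`. -/
def adjSwaps (n : ℕ) [NeZero n] : Submonoid (Equiv.Perm (ZMod (2 * n))) :=
  Submonoid.closure {g | ∃ i, 1 ≤ i ∧ i + 1 < n ∧ g = adjSwap n i}

theorem adjSwap_mem_adjSwaps {i : ℕ} (hi1 : 1 ≤ i) (hi : i + 1 < n) :
    adjSwap n i ∈ adjSwaps n :=
  Submonoid.subset_closure ⟨i, hi1, hi, rfl⟩

theorem Centered.mul_mem_adjSwaps (htn : t < 2 * n) (hk : 2 * n < k * t)
    (hcov : NoCover k 𝒰)
    (hfull : ∀ σ ∈ matchingAut (opp (n := n)), #(arcStarts t 𝒰 σ) = 2 * n - t)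
    {σ : Equiv.Perm (ZMod (2 * n))} (hσG : σ ∈ matchingAut (opp (n := n)))
    (hσ : Centered t 𝒰 σ) {h : Equiv.Perm (ZMod (2 * n))} (hh : h ∈ adjSwaps n) :
    Centered t 𝒰 (σ * h) := by
  suffices H : ∀ σ ∈ matchingAut (opp (n := n)), Centered t 𝒰 σ →
      σ * h ∈ matchingAut (opp (n := n)) ∧ Centered t 𝒰 (σ * h) from (H σ hσG hσ).2
  clear hσ hσG
  induction hh using Submonoid.closure_induction with
  | mem g hg =>
    obtain ⟨i, hi1, hi, rfl⟩ := hg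
    exact fun σ hσG hσ => ⟨mul_mem hσG (adjSwap_mem_matchingAut i),
      hσ.mul_adjSwap htn hk hcov hfull hσG hi1 hi⟩
  | one => exact fun σ hσG hσ => by simpa using ⟨hσG, hσ⟩
  | mul g g' _ _ ihg ihg' =>
    intro σ hσG hσ
    rw [← mul_assoc]
    exact ihg' _ (ihg σ hσG hσ).1 (ihg σ hσG hσ).2

theorem pairSwap_self (a : ZMod (2 * n)) : pairSwap opp opp_opp opp_ne a a = 1 := by
  ext1 x
  rw [pairSwap_apply, Equiv.Perm.one_apply]
  grind

theorem pairSwap_comm (a b : ZMod (2 * n)) :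
    pairSwap opp opp_opp opp_ne a b = pairSwap opp opp_opp opp_ne b a := by
  have := opp_opp a
  have := opp_opp b
  have := opp_ne a
  have := opp_ne b
  ext1 x
  simp only [pairSwap_apply]
  grind

theorem pairSwap_opp (a b : ZMod (2 * n)) :
    pairSwap opp opp_opp opp_ne (opp a) (opp b) = pairSwap opp opp_opp opp_ne a b := by
  have := opp_ne a
  have := opp_ne b
  ext1 x
  simp only [pairSwap_apply, opp_opp]
  have := opp_opp a
  have := opp_opp b
  grind

theorem pairSwap_conj {a b c : ZMod (2 * n)} (hab : a ≠ b) (hac : a ≠ c) (hbc : b ≠ c)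
    (hab' : a ≠ opp b) (hac' : a ≠ opp c) (hbc' : b ≠ opp c) :
    pairSwap opp opp_opp opp_ne a c = pairSwap opp opp_opp opp_ne b c *
      pairSwap opp opp_opp opp_ne a b * pairSwap opp opp_opp opp_ne b c := by
  have := opp_opp a
  have := opp_opp b
  have := opp_opp c
  have := opp_ne a
  have := opp_ne b
  have := opp_ne c
  ext1 x
  simp only [Equiv.Perm.mul_apply]
  by_cases h1 : x = a
  · simp only [pairSwap_apply]; grind
  by_cases h2 : x = b
  · simp only [pairSwap_apply]; grind
  by_cases h3 : x = c
  · simp only [pairSwap_apply]; grind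
  by_cases h4 : x = opp a
  · simp only [pairSwap_apply]; grind
  by_cases h5 : x = opp b
  · simp only [pairSwap_apply]; grind
  by_cases h6 : x = opp c
  · simp only [pairSwap_apply]; grind
  · simp only [pairSwap_apply, h1, h2, h3, h4, h5, h6, if_false]

theorem pairSwap_natCast_mem_adjSwaps {i j : ℕ} (hi : 1 ≤ i) (hij : i < j) (hj : j < n) :
    pairSwap opp opp_opp opp_ne (i : ZMod (2 * n)) (j : ZMod (2 * n)) ∈ adjSwaps n := by
  induction j, hij using Nat.le_induction with
  | base => exact adjSwap_mem_adjSwaps hi hj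
  | succ j hij ih =>
    have hne : ∀ p q : ℕ, p < n → q < n → p ≠ q →
        (p : ZMod (2 * n)) ≠ q ∧ (p : ZMod (2 * n)) ≠ opp (q : ZMod (2 * n)) := by
      intro p q hp hq hpq
      rw [opp_natCast, Ne, Ne, eq_natCast_iff (by omega), eq_natCast_iff (by omega),
        ZMod.val_natCast_of_lt (by omega)]
      omega
    have h := adjSwap_mem_adjSwaps (n := n) (i := j) (by omega) hj
    rw [pairSwap_conj (b := (j : ZMod (2 * n))) (hne i j (by omega) (by omega) (by omega)).1
      (hne i (j + 1) (by omega) (by omega) (by omega)).1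
      (hne j (j + 1) (by omega) (by omega) (by omega)).1
      (hne i j (by omega) (by omega) (by omega)).2
      (hne i (j + 1) (by omega) (by omega) (by omega)).2
      (hne j (j + 1) (by omega) (by omega) (by omega)).2]
    exact mul_mem (mul_mem h (ih (by omega))) h

theorem pairSwap_mem_adjSwaps_of_val_lt {a b : ZMod (2 * n)} (ha : 0 < a.val) (han : a.val < n)
    (hb : 0 < b.val) (hbn : b.val < n) : pairSwap opp opp_opp opp_ne a b ∈ adjSwaps n := by
  rcases lt_trichotomy a.val b.val with h | h | h
  · have := pairSwap_natCast_mem_adjSwaps (n := n) ha h hbn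
    rwa [ZMod.natCast_zmod_val, ZMod.natCast_zmod_val] at this
  · rw [ZMod.val_injective _ h, pairSwap_self]
    exact one_mem _
  · have := pairSwap_natCast_mem_adjSwaps (n := n) hb h han
    rw [ZMod.natCast_zmod_val, ZMod.natCast_zmod_val] at this
    rwa [pairSwap_comm]

/-- The side of a position: the poles `0` and `n` have the colors `0` and `1`, and the open half
circles between them have the colors `2` and `3`. -/
def side (x : ZMod (2 * n)) : ℕ :=
  if x.val = 0 then 0 else if x.val = n then 1 else if x.val < n then 2 else 3

theorem side_opp {a b : ZMod (2 * n)} (h : side a = side b) : side (opp a) = side (opp b) := by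
  have hn := NeZero.pos n
  have ha := ZMod.val_lt a
  have hb := ZMod.val_lt b
  have ha' := val_opp a
  have hb' := val_opp b
  simp only [side] at *
  split_ifs at * <;> omega

theorem pairSwap_mem_adjSwaps {a b : ZMod (2 * n)} (h : side a = side b) :
    pairSwap opp opp_opp opp_ne a b ∈ adjSwaps n := by
  have hn := NeZero.pos n
  have ha := ZMod.val_lt a
  have hb := ZMod.val_lt b
  by_cases hab : a.val = b.val
  · rw [ZMod.val_injective _ hab, pairSwap_self]
    exact one_mem _
  · rcases lt_or_ge a.val n with han | han
    · refine pairSwap_mem_adjSwaps_of_val_lt ?_ han ?_ ?_ <;>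
      · simp only [side] at h
        split_ifs at h <;> omega
    · rw [← pairSwap_opp]
      refine pairSwap_mem_adjSwaps_of_val_lt ?_ ?_ ?_ ?_ <;>
      · rw [val_opp]
        simp only [side] at h
        split_ifs at h ⊢ <;> omega

theorem card_eq_sides {A : Finset (ZMod (2 * n))} (hA : Indep opp A) (h0 : 0 ∈ A) :
    #{x ∈ A | side x = 0} = 1 ∧ #{x ∈ A | side x = 1} = 0 ∧
      #A = 1 + #{x ∈ A | side x = 2} + #{x ∈ A | side x = 3} := by
  have hn := NeZero.pos n
  have hs0 : ({x ∈ A | side x = 0} : Finset _) = {0} := by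
    ext x
    simp only [mem_filter, mem_singleton]
    constructor
    · rintro ⟨_, hx⟩
      rw [← ZMod.val_eq_zero]
      simp only [side] at hx
      split_ifs at hx
      assumption
    · rintro rfl
      exact ⟨h0, by simp [side]⟩
  have hs1 : ({x ∈ A | side x = 1} : Finset _) = ∅ := by
    rw [filter_eq_empty_iff]
    intro x hxA hx
    refine hA 0 h0 ?_
    have : x = opp 0 := by
      apply ZMod.val_injective
      rw [val_opp, ZMod.val_zero, if_pos hn, zero_add]
      simp only [side] at hx
      split_ifs at hx <;> omega
    rwa [← this]
  have hsum := card_eq_sum_card_fiberwise (s := A) (f := side) (t := range 4) (by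
    intro x _
    simp only [side, coe_range, Set.mem_Iio]
    split_ifs <;> omega)
  rw [sum_range_succ, sum_range_succ, sum_range_succ, sum_range_one, hs0, hs1] at hsum
  rw [hs0, hs1]
  simpa using hsum

/-- Every independent set that contains `0` is obtained from an arc through `0` by permuting
the pairs, without exchanging the two half circles. The position of the arc is given by the number
of elements on the second half circle. -/
theorem exists_smul_arc_eq {A : Finset (ZMod (2 * n))} (hA : Indep opp A) (h0 : 0 ∈ A) :
    ∃ h ∈ adjSwaps n, ∃ a, 0 ∈ arc #A a ∧ h • arc #A a = A := by
  have hn := NeZero.pos n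
  have hAn : 2 * #A ≤ 2 * n := (hA.two_mul_card_le opp_opp).trans_eq (ZMod.card _)
  obtain ⟨hA0, hA1, hAs⟩ := card_eq_sides hA h0
  set j := #{x ∈ A | side x = 3} with hj
  have h0' : (0 : ZMod (2 * n)) ∈ arc #A (-(j : ZMod (2 * n))) :=
    mem_arc_iff_exists.2 ⟨j, by omega, by ring⟩
  have hI := indep_arc (n := n) (s := #A) (by omega) (-(j : ZMod (2 * n)))
  obtain ⟨hB0, hB1, hBs⟩ := card_eq_sides hI h0'
  have hB3 : #{x ∈ arc #A (-(j : ZMod (2 * n))) | side x = 3} = j := by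
    have h : ({x ∈ arc #A (-(j : ZMod (2 * n))) | side x = 3} : Finset _) =
        arc j (-(j : ZMod (2 * n))) := by
      ext x
      have hx := ZMod.val_lt x
      have hside : side x = 3 ↔ n < x.val := by
        simp only [side]
        split_ifs <;> simp <;> omega
      rw [mem_filter, mem_arc, mem_arc, sub_neg_eq_add, ZMod.val_add,
        ZMod.val_natCast_of_lt (by omega), hside]
      rcases lt_or_ge (x.val + j) (2 * n) with h | h
      · rw [Nat.mod_eq_of_lt h]
        omega
      · rw [Nat.mod_eq_sub_mod h, Nat.mod_eq_of_lt (by omega)]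
        omega
    rw [h, card_arc (by omega)]
  rw [card_arc (by omega), hB3] at hBs
  obtain ⟨h, hh, hhA⟩ := exists_smul_eq_of_card_color_eq opp_opp opp_ne side
    (fun a b => side_opp) (adjSwaps n) (fun a b => pairSwap_mem_adjSwaps) hI hA (by
      intro c
      match c with
      | 0 => rw [hB0, hA0]
      | 1 => rw [hB1, hA1]
      | 2 => omega
      | 3 => rw [hB3]
      | c + 4 =>
        have hne : ∀ x : ZMod (2 * n), side x ≠ c + 4 := by
          intro x
          simp only [side]
          split_ifs <;> omega
        simp [hne])
  exact ⟨h, hh, _, h0', hhA⟩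

theorem addRight_smul_arc (p a : ZMod (2 * n)) :
    Equiv.addRight p • arc t a = arc t (a + p) := by
  ext x
  rw [← inv_smul_mem_iff, mem_arc, mem_arc]
  simp only [Equiv.Perm.smul_def, Equiv.Perm.inv_def, Equiv.addRight_symm, Equiv.coe_addRight]
  rw [show x + -p - a = x - (a + p) by ring]

/-- If `2 * n < k * t`, then the largest families of balanced sets of size `t`, no `k` of which
cover, are the complements of stars. -/
theorem eq_costar_of_card_eq (ht : 0 < t) (htn : t < 2 * n) (hk : 2 * n < k * t)
    (h𝒰 : 𝒰 ⊆ balancedSets n t) (hcov : NoCover k 𝒰)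
    (hcard : ∀ x, #𝒰 = #(costar n t x)) : ∃ p, 𝒰 = costar n t p := by
  have hfull : ∀ σ ∈ matchingAut (opp (n := n)), #(arcStarts t 𝒰 σ) = 2 * n - t := fun σ hσ =>
    card_arcStarts_of_card_eq htn.le hk.le h𝒰 hcov (hcard 0) hσ
  obtain ⟨p, hp⟩ := exists_center_of_card_eq ht htn hk (hcov.arcStarts 1) (hfull 1 (one_mem _))
  refine ⟨p, ?_⟩
  have hρ : Centered t 𝒰 (Equiv.addRight p) := by
    intro a
    have h := hp (a + p)
    rw [mem_arcStarts, one_smul] at h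
    rw [addRight_smul_arc, h, mem_arc, mem_arc, show p - (a + p) = 0 - a by ring]
  have hc : ∀ h ∈ adjSwaps n, Centered t 𝒰 (Equiv.addRight p * h) := fun h hh =>
    hρ.mul_mem_adjSwaps htn hk hcov hfull (addRight_mem_matchingAut p) hh
  have hrot : ∀ U : Finset (ZMod (2 * n)), Indep opp U → p ∈ U → ∃ h ∈ adjSwaps n, ∃ a,
      0 ∈ arc #U a ∧ (Equiv.addRight p * h) • arc #U a = U := by
    intro U hU hpU
    have hinv := inv_mem (addRight_mem_matchingAut p)
    obtain ⟨h, hh, a, h0, ha⟩ := exists_smul_arc_eq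
      (hU.smul (mem_matchingAut.1 hinv)) (by
        rw [mem_inv_smul_finset_iff]
        simpa [Equiv.Perm.smul_def] using hpU)
    rw [card_smul_finset] at h0 ha
    exact ⟨h, hh, a, h0, by rw [mul_smul, ha, smul_inv_smul]⟩
  have hV : Fintype.card (ZMod (2 * n)) = 2 * n := ZMod.card _
  rcases le_total t n with htn' | htn'
  · refine eq_of_subset_of_card_le (fun U hU => mem_filter.2 ⟨h𝒰 hU, fun hpU => ?_⟩)
      (hcard p).ge
    obtain ⟨hUb, hUt⟩ := mem_balancedSets.1 (h𝒰 hU)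
    obtain ⟨h, hh, a, h0, ha⟩ := hrot U (hUb.indep opp_opp (by omega)) hpU
    rw [hUt] at h0 ha
    exact ((hc h hh a).1 (ha ▸ hU)) h0
  · refine (eq_of_subset_of_card_le (fun U hU => ?_) (hcard p).le).symm
    obtain ⟨hUQ, hpU⟩ := mem_filter.1 hU
    obtain ⟨hUb, hUt⟩ := mem_balancedSets.1 hUQ
    obtain ⟨h, hh, a, h0, ha⟩ := hrot Uᶜ (hUb.indep_compl opp_opp (by omega)) (mem_compl.2 hpU)
    have hUc : #Uᶜ = 2 * n - t := by rw [card_compl, hUt, hV]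
    rw [hUc] at h0 ha
    have harc : (arc (2 * n - t) a)ᶜ = arc t (a + ((2 * n - t : ℕ) : ZMod (2 * n))) := by
      rw [compl_arc (by omega), Nat.sub_sub_self htn.le]
    rw [← compl_inj_iff, ← smul_compl, compl_compl, harc] at ha
    rw [← ha, hc h hh, ← harc, mem_compl, not_not]
    exact h0

end Extremal

/-! ### The size of a star -/

section Counting

/-- Counting the pairs `A ⊆ B` of independent sets with `#A = t` and `#B = t + 1`. -/
theorem card_indep_mul {V : Type*} [Fintype V] [DecidableEq V] {ν : V → V}
    (hν : ∀ x, ν (ν x) = x) (hne : ∀ x, ν x ≠ x) (t : ℕ) :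
    #{A : Finset V | Indep ν A ∧ #A = t} * (Fintype.card V - 2 * t) =
      #{A : Finset V | Indep ν A ∧ #A = t + 1} * (t + 1) := by
  refine card_mul_eq_card_mul (· ⊆ ·) ?_ ?_
  · intro A hA
    obtain ⟨hAi, rfl⟩ := (mem_filter.1 hA).2
    have hinj : Function.Injective ν := Function.Involutive.injective hν
    have hdisj : Disjoint A (A.image ν) := by
      rw [disjoint_left]
      intro x hx hx'
      obtain ⟨y, hy, rfl⟩ := mem_image.1 hx'
      exact hAi y hy hx
    have himg : ∀ v, v ∈ A.image ν ↔ ν v ∈ A := by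
      intro v
      rw [mem_image]
      exact ⟨fun ⟨y, hy, h⟩ => by rwa [← h, hν], fun h => ⟨_, h, hν v⟩⟩
    have hcard : #(A ∪ A.image ν)ᶜ = Fintype.card V - 2 * #A := by
      rw [card_compl, card_union_of_disjoint hdisj, card_image_of_injective _ hinj, two_mul]
    rw [← hcard, ← card_image_of_injOn (s := (A ∪ A.image ν)ᶜ) (f := fun v => insert v A)]
    · congr 1
      ext B
      simp only [mem_bipartiteAbove, mem_filter, mem_univ, true_and, mem_image, mem_compl,
        mem_union, himg, not_or]
      constructor
      · rintro ⟨⟨hB, hBc⟩, hAB⟩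
        obtain ⟨v, hvB, hvA⟩ : ∃ v ∈ B, v ∉ A := by
          by_contra! h
          have := card_le_card (show B ⊆ A from h)
          omega
        refine ⟨v, ⟨hvA, fun h => hB v hvB (hAB h)⟩, ?_⟩
        refine eq_of_subset_of_card_le (insert_subset hvB hAB) ?_
        rw [card_insert_of_notMem hvA, hBc]
      · rintro ⟨v, ⟨hvA, hvA'⟩, rfl⟩
        refine ⟨⟨?_, card_insert_of_notMem hvA⟩, subset_insert _ _⟩
        intro w hw hw'
        rcases mem_insert.1 hw with rfl | hw <;> rcases mem_insert.1 hw' with h | hw'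
        · exact hne _ h
        · exact hvA' hw'
        · rw [← h, hν] at hvA'
          exact hvA' hw
        · exact hAi w hw hw'
    · intro v hv w _ hvw
      have hv : v ∉ A := by
        simp only [coe_compl, Set.mem_compl_iff, mem_coe, mem_union, not_or] at hv
        exact hv.1
      have h : v ∈ insert w A := by
        rw [← show insert v A = insert w A from hvw]
        exact mem_insert_self _ _
      exact (mem_insert.1 h).resolve_right hv
  · intro B hB
    obtain ⟨hB, hBc⟩ := (mem_filter.1 hB).2
    have h : ({A : Finset V | Indep ν A ∧ #A = t} : Finset _).bipartiteBelow (· ⊆ ·) B =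
        powersetCard t B := by
      ext A
      simp only [mem_bipartiteBelow, mem_filter, mem_univ, true_and, mem_powersetCard]
      exact ⟨fun ⟨⟨_, h1⟩, h2⟩ => ⟨h2, h1⟩,
        fun ⟨h1, h2⟩ => ⟨⟨fun v hv hv' => hB v (h1 hv) (h1 hv'), h2⟩, h1⟩⟩
    rw [h, card_powersetCard, hBc, Nat.choose_succ_self_right]

variable {n t r : ℕ} [NeZero n]

theorem card_indep (t : ℕ) :
    #{A : Finset (ZMod (2 * n)) | Indep opp A ∧ #A = t} = 2 ^ t * n.choose t := by
  induction t with
  | zero =>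
    have h : ({A : Finset (ZMod (2 * n)) | Indep opp A ∧ #A = 0} : Finset _) = {∅} := by
      ext A
      simp only [mem_filter, mem_univ, true_and, card_eq_zero, mem_singleton, and_iff_right_iff_imp]
      rintro rfl
      simp [Indep]
    rw [h]
    simp
  | succ t ih =>
    have h := card_indep_mul (opp_opp (n := n)) opp_ne t
    rw [ih, ZMod.card, ← Nat.mul_sub] at h
    refine Nat.eq_of_mul_eq_mul_right (by omega : 0 < t + 1) (h.symm.trans ?_)
    have h' := Nat.choose_succ_right_eq n t
    calc 2 ^ t * n.choose t * (2 * (n - t)) = 2 ^ (t + 1) * (n.choose t * (n - t)) := by ring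
      _ = _ := by rw [← h']; ring

theorem card_balancedSets (ht : t ≤ n) : #(balancedSets n t) = 2 ^ t * n.choose t := by
  rw [← card_indep]
  congr 1
  ext A
  simp only [mem_balancedSets, mem_filter, mem_univ, true_and]
  refine and_congr_left fun hA => ⟨fun h => h.indep opp_opp ?_, Or.inl⟩
  rw [ZMod.card, hA]
  omega

theorem card_balancedSets_sub (ht : t ≤ 2 * n) :
    #(balancedSets n (2 * n - t)) = #(balancedSets n t) := by
  have h : ∀ {s : ℕ} {A : Finset (ZMod (2 * n))}, A ∈ balancedSets n s →
      Aᶜ ∈ balancedSets n (2 * n - s) := by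
    intro s A hA
    obtain ⟨h1, h2⟩ := mem_balancedSets.1 hA
    exact mem_balancedSets.2 ⟨h1.compl, by rw [card_compl, ZMod.card, h2]⟩
  refine card_nbij' compl compl (fun A hA => ?_) (fun A hA => h hA)
    (fun _ _ => compl_compl _) (fun _ _ => compl_compl _)
  have := h hA
  rwa [Nat.sub_sub_self ht] at this

theorem card_costar_sub (hr1 : 1 ≤ r) (hr : r < 2 * n) (x : ZMod (2 * n)) :
    #(costar n (2 * n - r) x) = matchingBound n r := by
  have hn := NeZero.pos n
  have h := two_mul_card_costar (t := 2 * n - r) (Nat.sub_le _ _) x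
  refine Nat.eq_of_mul_eq_mul_left (by omega : 0 < 2 * n) (h.trans ?_)
  rw [Nat.sub_sub_self hr.le]
  unfold matchingBound
  split_ifs with hrn
  · rw [card_balancedSets_sub hr.le, card_balancedSets hrn]
    obtain ⟨N, rfl⟩ : ∃ N, n = N + 1 := ⟨n - 1, by omega⟩
    obtain ⟨s, rfl⟩ : ∃ s, r = s + 1 := ⟨r - 1, by omega⟩
    have h1 := Nat.add_one_mul_choose_eq N s
    simp only [Nat.add_sub_cancel]
    calc (s + 1) * (2 ^ (s + 1) * (N + 1).choose (s + 1))
        = 2 ^ (s + 1) * ((N + 1).choose (s + 1) * (s + 1)) := by ring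
      _ = _ := by rw [← h1]; ring
  · obtain ⟨t, ht⟩ : ∃ t, 2 * n - r = t + 1 := ⟨2 * n - r - 1, by omega⟩
    rw [ht, card_balancedSets (by omega)]
    obtain ⟨N, rfl⟩ : ∃ N, n = N + 1 := ⟨n - 1, by omega⟩
    have h1 := Nat.add_one_mul_choose_eq N t
    have h2 := Nat.choose_succ_succ' N t
    have hrt : r + (t + 1) = 2 * (N + 1) := by omega
    simp only [Nat.add_sub_cancel]
    rw [h2] at h1 ⊢
    zify at h1 hrt ⊢
    rw [pow_succ]
    linear_combination 2 * (2 : ℤ) ^ t * (N.choose t + N.choose (t + 1)) * hrt +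
      2 * (2 : ℤ) ^ t * h1

end Counting

/-! ### Intersecting families in the matching graph -/

section Matching

/-- The sets of a `k`-wise intersecting family have complements of which no `k` cover. -/
theorem noCover_image_compl {V : Type*} [Fintype V] [DecidableEq V] [Nonempty V] {k : ℕ}
    {F : Finset (Finset V)} (hF : KWiseIntersecting k F) : NoCover k (F.image compl) := by
  intro D hD hDk
  rcases D.eq_empty_or_nonempty with rfl | ⟨U₀, hU₀⟩
  · exact ⟨Classical.arbitrary V, by simp⟩
  · -- The members of `D` are listed, with repetitions of `U₀` at the end.
    let A : Fin k → Finset V := fun i =>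
      if h : i.val < #D then (D.equivFin.symm ⟨i, h⟩).1ᶜ else U₀ᶜ
    have hcompl : ∀ U ∈ D, Uᶜ ∈ F := by
      intro U hU
      obtain ⟨B, hB, rfl⟩ := mem_image.1 (hD hU)
      rwa [compl_compl]
    obtain ⟨x, hx⟩ := hF A (by
      intro i
      simp only [A]
      split_ifs with h
      · exact hcompl _ (D.equivFin.symm ⟨i, h⟩).2
      · exact hcompl _ hU₀)
    refine ⟨x, fun U hU => ?_⟩
    have h := hx ⟨(D.equivFin ⟨U, hU⟩).val, (D.equivFin ⟨U, hU⟩).2.trans_le hDk⟩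
    simpa [A] using h

variable {n r : ℕ} [NeZero n]

/-- The matching of the opposite points of a cycle. -/
def pairGraph (n : ℕ) [NeZero n] : SimpleGraph (ZMod (2 * n)) where
  Adj u v := v = opp u
  symm := ⟨fun u v h => by rw [h, opp_opp]⟩
  loopless := ⟨fun u h => opp_ne u h.symm⟩

theorem isIndepSet_pairGraph_iff (A : Finset (ZMod (2 * n))) :
    (pairGraph n).IsIndepSet (A : Set (ZMod (2 * n))) ↔ Indep opp A := by
  constructor
  · intro h v hv hv'
    exact h hv hv' (opp_ne v).symm rfl
  · intro h u hu v hv _ hadj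
    have hadj : v = opp u := hadj
    rw [hadj] at hv
    exact h u hu hv

/-- A set that meets every pair contains an independent set that meets every pair. -/
theorem exists_indep_subset {A : Finset (ZMod (2 * n))} (hA : Indep opp Aᶜ) :
    ∃ B ⊆ A, Indep opp B ∧ #B = n := by
  have hval : ∀ v : ZMod (2 * n), (opp v).val < n ↔ ¬ v.val < n := by
    intro v
    have := ZMod.val_lt v
    rw [val_opp]
    split_ifs <;> omega
  have hV := ZMod.card (2 * n)
  -- Of two partners in `A`, the one in the first half is chosen.
  set B : Finset (ZMod (2 * n)) := {v ∈ A | v.val < n ∨ opp v ∉ A} with hB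
  have hmem : ∀ v, v ∈ B ↔ v ∈ A ∧ (v.val < n ∨ opp v ∉ A) := by simp [hB]
  have h1 : Indep opp B := by
    intro v hv hv'
    rw [hmem] at hv hv'
    rw [hval, opp_opp] at hv'
    tauto
  have h2 : Indep opp Bᶜ := by
    intro v hv hv'
    have := hA v
    have := hA (opp v)
    rw [mem_compl, hmem] at hv hv'
    rw [hval] at hv'
    simp only [mem_compl, opp_opp] at *
    tauto
  have h3 := h1.two_mul_card_le opp_opp
  have h4 := h2.two_mul_card_le opp_opp
  rw [card_compl] at h4
  exact ⟨B, filter_subset _ _, h1, by omega⟩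

theorem indepNum_pairGraph : (pairGraph n).indepNum = n := by
  have hV := ZMod.card (2 * n)
  refine le_antisymm ?_ ?_
  · obtain ⟨A, hA⟩ := (pairGraph n).exists_isNIndepSet_indepNum
    have h1 := ((isIndepSet_pairGraph_iff A).1 hA.isIndepSet).two_mul_card_le opp_opp
    have h2 := hA.card_eq
    omega
  · obtain ⟨B, _, hB, hBc⟩ := exists_indep_subset (n := n) (A := univ) (by simp [Indep])
    have h := ((isIndepSet_pairGraph_iff B).2 hB).card_le_indepNum
    rwa [hBc] at h

theorem inP_pairGraph_iff (A : Finset (ZMod (2 * n))) :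
    InP (pairGraph n) A ↔ IsBalanced opp A := by
  have hV := ZMod.card (2 * n)
  refine or_congr (isIndepSet_pairGraph_iff A) ?_
  rw [indepNum_pairGraph]
  constructor
  · rintro ⟨B, hBA, hB⟩
    have hBi := (isIndepSet_pairGraph_iff B).1 hB.isIndepSet
    have h : Indep opp Bᶜ := by
      refine Indep.of_compl opp_opp (by rwa [compl_compl]) ?_
      rw [card_compl, hV, hB.card_eq]
      omega
    intro v hv hv'
    rw [mem_compl] at hv hv'
    exact h v (mem_compl.2 fun h => hv (hBA h)) (mem_compl.2 fun h => hv' (hBA h))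
  · intro hA
    obtain ⟨B, hBA, hB, hBc⟩ := exists_indep_subset hA
    exact ⟨B, hBA, ⟨(isIndepSet_pairGraph_iff B).2 hB, hBc⟩⟩

theorem familyP_pairGraph : familyP (pairGraph n) r = balancedSets n r := by
  ext A
  rw [mem_balancedSets, ← inP_pairGraph_iff]
  simp [familyP]

theorem image_compl_eq_costar_iff (hr : r ≤ 2 * n) (x : ZMod (2 * n))
    (F : Finset (Finset (ZMod (2 * n)))) :
    F.image compl = costar n (2 * n - r) x ↔ F = starP (pairGraph n) r x := by
  have hV := ZMod.card (2 * n)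
  have hmem : ∀ A, Aᶜ ∈ costar n (2 * n - r) x ↔ A ∈ starP (pairGraph n) r x := by
    intro A
    have hA := card_le_univ A
    have hstar : A ∈ starP (pairGraph n) r x ↔ A ∈ balancedSets n r ∧ x ∈ A := by
      simp [starP, familyP_pairGraph]
    rw [hstar, costar, mem_filter, mem_balancedSets, mem_balancedSets, mem_compl, not_not,
      card_compl, hV]
    refine and_congr_left fun _ => and_congr ⟨fun h => ?_, fun h => h.compl⟩ (by omega)
    simpa using h.compl
  constructor
  · intro h
    ext A
    rw [← hmem, ← h]
    simp
  · rintro rfl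
    ext U
    rw [mem_image]
    constructor
    · rintro ⟨A, hA, rfl⟩
      exact (hmem A).2 hA
    · intro hU
      exact ⟨Uᶜ, (hmem _).1 (by rwa [compl_compl]), compl_compl U⟩

theorem card_starP_pairGraph (hr1 : 1 ≤ r) (hr : r < 2 * n) (x : ZMod (2 * n)) :
    #(starP (pairGraph n) r x) = matchingBound n r := by
  rw [← card_costar_sub hr1 hr x, ← (image_compl_eq_costar_iff hr.le x _).2 rfl,
    card_image_of_injective _ compl_injective]

variable {k : ℕ} {F : Finset (Finset (ZMod (2 * n)))}

theorem image_compl_subset_balancedSets (hFP : F ⊆ familyP (pairGraph n) r) :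
    F.image compl ⊆ balancedSets n (2 * n - r) := by
  intro U hU
  obtain ⟨A, hA, rfl⟩ := mem_image.1 hU
  rw [familyP_pairGraph] at hFP
  obtain ⟨h1, h2⟩ := mem_balancedSets.1 (hFP hA)
  exact mem_balancedSets.2 ⟨h1.compl, by rw [card_compl, ZMod.card, h2]⟩

theorem card_le_matchingBound (hr1 : 1 ≤ r) (hr : r < 2 * n) (hk : 2 * n ≤ k * (2 * n - r))
    (hFP : F ⊆ familyP (pairGraph n) r) (hF : KWiseIntersecting k F) :
    #F ≤ matchingBound n r := by
  rw [← card_image_of_injective F compl_injective, ← card_costar_sub hr1 hr 0]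
  exact card_le_card_costar (Nat.sub_le _ _) hk (image_compl_subset_balancedSets hFP)
    (noCover_image_compl hF) 0

theorem card_eq_matchingBound_iff (hr1 : 1 ≤ r) (hr : r < 2 * n) (hk : 2 * n < k * (2 * n - r))
    (hFP : F ⊆ familyP (pairGraph n) r) (hF : KWiseIntersecting k F) :
    #F = matchingBound n r ↔ ∃ x, F = starP (pairGraph n) r x := by
  constructor
  · intro h
    obtain ⟨p, hp⟩ := eq_costar_of_card_eq (by omega) (by omega) hk
      (image_compl_subset_balancedSets hFP) (noCover_image_compl hF)
      (fun x => by rw [card_image_of_injective _ compl_injective, h, card_costar_sub hr1 hr x])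
    exact ⟨p, (image_compl_eq_costar_iff hr.le p F).1 hp⟩
  · rintro ⟨x, rfl⟩
    exact card_starP_pairGraph hr1 hr x

/-- For positive `n`, the types `Fin (2 * n)` and `ZMod (2 * n)` agree by definition. -/
theorem matchingGraph_eq_pairGraph (m : ℕ) : matchingGraph (m + 1) = pairGraph (m + 1) := by
  refine SimpleGraph.ext (funext fun u => funext fun v => propext ?_)
  change ZMod (2 * (m + 1)) at u v
  have hu := ZMod.val_lt u
  have hv := ZMod.val_lt v
  change u.val + (m + 1) = v.val ∨ v.val + (m + 1) = u.val ↔ v = opp u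
  rw [← (ZMod.val_injective _).eq_iff, val_opp]
  split_ifs <;> omega

end Matching

end MatchingEKR

theorem theorem3 (n k r : ℕ) (hk : 2 ≤ k) (hr1 : 1 ≤ r)
    (hr : (r : ℝ) ≤ ((k : ℝ) - 1) * (2 * (n : ℝ)) / (k : ℝ))
    (F : Finset (Finset (Fin (2 * n)))) (hFP : F ⊆ familyP (matchingGraph n) r)
    (hF : KWiseIntersecting k F) :
    F.card ≤ matchingBound n r ∧
    ((r : ℝ) < ((k : ℝ) - 1) * (2 * (n : ℝ)) / (k : ℝ) →
      (F.card = matchingBound n r ↔ ∃ x : Fin (2 * n), F = starP (matchingGraph n) r x)) ∧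
    (n < r → ∀ x : Fin (2 * n), (starP (matchingGraph n) r x).card =
      2 ^ (2 * n - r) * (n - 1).choose (2 * n - r)
        + 2 ^ (2 * n - r - 1) * (n - 1).choose (2 * n - r - 1)) := by
  have hk0 : (0 : ℝ) < k := by exact_mod_cast (by omega : 0 < k)
  have hkr : k * r + 2 * n ≤ k * (2 * n) := by
    rw [le_div_iff₀ hk0] at hr
    have h : (k : ℝ) * r + 2 * n ≤ k * (2 * n) := by linarith
    exact_mod_cast h
  rcases n with _ | m
  · have := Nat.mul_le_mul (by omega : 1 ≤ k) hr1
    omega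
  have hrn : r < 2 * (m + 1) := by
    by_contra! h
    have := Nat.mul_le_mul_left k h
    omega
  have hsub := Nat.mul_sub k (2 * (m + 1)) r
  rw [MatchingEKR.matchingGraph_eq_pairGraph] at hFP ⊢
  refine ⟨?_, fun hlt => ?_, fun hn x => ?_⟩
  · exact MatchingEKR.card_le_matchingBound hr1 hrn (by omega) hFP hF
  · have hkr' : k * r + 2 * (m + 1) < k * (2 * (m + 1)) := by
      rw [lt_div_iff₀ hk0] at hlt
      have h : (k : ℝ) * r + 2 * ((m + 1 : ℕ) : ℝ) < k * (2 * ((m + 1 : ℕ) : ℝ)) := by linarith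
      exact_mod_cast h
    exact MatchingEKR.card_eq_matchingBound_iff hr1 hrn (by omega) hFP hF
  · refine (MatchingEKR.card_starP_pairGraph hr1 hrn x).trans ?_
    rw [matchingBound, if_neg (by omega)]
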